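/- Let $T$ be a complete (consistent) first-order theory in a language $L$ and let $\mathcal M$ be a monster model of $T$ (as saturated as needed). For $m\in\mathbb N$ and a cardinal $\kappa$, an *srd-pattern of width $\kappa$ witnessed by $m$-formulas* consists of $L$-formulas $\varphi_i(x;y_i)$ $(i\in\kappa)$, where $x$ is an $m$-tuple and $y_i$ a finite tuple of variables, and of parameter tuples $b_{i,j}\in\mathcal M^{|y_i|}$ $(i\in\kappa,\ j\in\omega)$ such that (a) for every $\eta\in\omega^\kappa$ the set of formulas $\{\varphi_i(x;b_{i,j}) : j\ge\eta(i)\}\cup\{\neg\varphi_i(x;b_{i,j}) : j<\eta(i)\}$ $(i\in\kappa,\ j\in\omega)$ is consistent; (b) $\varphi_i(\mathcal M,b_{i,j})\subsetneq\varphi_i(\mathcal M,b_{i,j+1})$ for all $i\in\kappa$ and $j\in\omega$. Let $\kappa^m_{\mathrm{srd}}(T)$ be the least cardinal $\kappa$ such that there is no srd-pattern of width $\kappa$ witnessed by $m$-formulas, and $\kappa^m_{\mathrm{srd}}(T)=\infty$ (larger than every cardinal, with $\infty+\lambda=\lambda+\infty=\infty$ for $\lambda$ a cardinal or $\infty$)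 if there is no such cardinal. Let $\kappa_{\mathrm{srd}}(T)=\sup_{m\in\omega}\kappa^m_{\mathrm{srd}}(T)$. Then: 1. For all $m,n\in\mathbb N$, $\kappa^{m+n}_{\mathrm{srd}}(T)+1\le\kappa^m_{\mathrm{srd}}(T)+\kappa^n_{\mathrm{srd}}(T)$. 2. For every $m\in\mathbb N$, if $\kappa^m_{\mathrm{srd}}(T)$ is infinite (an infinite cardinal or $\infty$), then $\kappa^m_{\mathrm{srd}}(T)=\kappa^1_{\mathrm{srd}}(T)=\kappa_{\mathrm{srd}}(T)$. -/

import Mathlib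

open FirstOrder Cardinal

universe u v

/-- The set `φ(M, b) = {a ∈ M^m : M ⊨ φ(a, b)}` defined in `M` by the formula `φ(x; y)`, `|x| = m`,
`|y| = k`, with the parameter tuple `b`. -/
def SRD.definedSet {L : FirstOrder.Language.{u, v}} {M : Type*} [L.Structure M] {m k : ℕ}
    (φ : L.Formula (Fin m ⊕ Fin k)) (b : Fin k → M) : Set (Fin m → M) :=
  {a | φ.Realize (Sum.elim a b)}

/-- The formulas `φ i (x; y_i)` with `|x| = m`, `|y_i| = k i`, together with the parameters `b i j`
of `M` form an srd-pattern in `M`.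

* `consistent`: for every `η : I → ω`, the set `{φ_i(x; b_{i,j})^{if (j ≥ η(i))} : i ∈ I, j ∈ ω}`
  is consistent, that is, every finite part of it has a solution in `M`. A tuple `a` satisfies
  `φ_i(x; b_{i,j})^{if (j ≥ η(i))}` iff (`φ_i(a; b_{i,j})` holds exactly when `j ≥ η(i)`).
* `ssubset`: `φ_i(M, b_{i,j})` is a proper subset of `φ_i(M, b_{i,j+1})`. -/
structure SRD.IsPattern {L : FirstOrder.Language.{u, v}} (M : Type*) [L.Structure M] {I : Type*} {m : ℕ}
    {k : I → ℕ} (φ : (i : I) → L.Formula (Fin m ⊕ Fin (k i)))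
    (b : (i : I) → ℕ → Fin (k i) → M) : Prop where
  consistent : ∀ (η : I → ℕ) (s : Finset (I × ℕ)), ∃ a : Fin m → M,
    ∀ p ∈ s, a ∈ SRD.definedSet (φ p.1) (b p.1 p.2) ↔ η p.1 ≤ p.2
  ssubset : ∀ (i : I) (j : ℕ),
    SRD.definedSet (φ i) (b i j) ⊂ SRD.definedSet (φ i) (b i (j + 1))

/-- In (a sufficiently saturated model of) `T` there is an srd-pattern of width `κ` witnessed by
`m`-formulas. A pattern in some model of `T` is the same as a pattern in the monster model
of the complete theory `T`: every model of `T` of size below the saturation embeds elementarily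
into the monster model. -/
def SRD.HasPattern {L : FirstOrder.Language.{u, v}} (T : L.Theory) (m : ℕ) (κ : Cardinal.{max u v}) : Prop :=
  ∃ (M : FirstOrder.Language.Theory.ModelType.{u, v, max u v} T) (I : Type (max u v)) (_ : #I = κ)
    (k : I → ℕ) (φ : (i : I) → L.Formula (Fin m ⊕ Fin (k i))) (b : (i : I) → ℕ → Fin (k i) → M),
    SRD.IsPattern M φ b

/-- `κ_srd^m(T)`: the least cardinal `κ` such that there is no srd-pattern of width `κ` witnessed
by `m`-formulas, and `⊤` (that is, `∞`) if there is no such cardinal. -/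
noncomputable def kappaSrdAt {L : FirstOrder.Language.{u, v}} (T : L.Theory) (m : ℕ) :
    WithTop Cardinal.{max u v} :=
  sInf ((fun κ : Cardinal.{max u v} => (κ : WithTop Cardinal.{max u v})) ''
    {κ | ¬ SRD.HasPattern T m κ})

/-- `κ_srd(T) = sup_m κ_srd^m(T)`. -/
noncomputable def kappaSrd {L : FirstOrder.Language.{u, v}} (T : L.Theory) : WithTop Cardinal.{max u v} :=
  ⨆ m : ℕ, kappaSrdAt T m

/-! The core is a splitting of the columns of a pattern in variables `(x, y)`, `|x| = m`, `|y| = n`: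
some columns carry a pattern in `y` over a fixed `x`, the others one in `x` (`exists_split`,
`HasPattern.split`). Cardinal arithmetic then yields 1, and 1 yields 2 by induction on `m`.

A column is an increasing chain of sets, and two of its indices bound a box: the points that enter
in between. A grid of shape `f` has `f j` boxes in column `j` and one `x` such that every choice of
one box per column of the support is met by some `y`. By Ramsey, at generic places the existence of
a grid depends only on the shape. Zorn gives a maximal `N : I → ℕ∞` all of whose finite subshapes
are good; `N ≥ 1`, since the pattern itself gives grids with one box per column.

On columns with `N i = ⊤`, arbitrarily fine grids over one `x` give all cuts in `y`. If `N i` is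
finite, maximality gives a bad shape `f` with `N i + 1` boxes in column `i` and at most `N j` in any
other column `j`. Take a grid of a good shape dominating `f` off column `i`, with one movable box in
column `i`, and ask of its `x` that it meet all combinations through an extra box there. This holds
if the extra box contains the movable one, and fails if it lies to its left, because `f` would then
be good. Lengthening the extra box gives an increasing chain of conditions on `x`, cut by the
movable box, and these cuts are independent over the columns (`exists_slice_pattern`). Only finitely
many columns and boxes are treated at once; an ultrapower assembles the patterns. -/

namespace SRD

/-! ### Ramsey's theorem through iterated ultrafilter quantifiers -/

section Ramsey

/-- `P [j₁, …, jᵣ]` holds for almost all `j₁`, almost all `j₂`, …, almost all `jᵣ`, with respect to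
a fixed nonprincipal ultrafilter on `ℕ`. -/
def Generic : ℕ → (List ℕ → Prop) → Prop
  | 0, P => P []
  | r + 1, P => ∀ᶠ j in (Filter.hyperfilter ℕ : Filter ℕ), Generic r fun l => P (j :: l)

/-- An ultrafilter decides every property, so each of its quantifiers commutes with negation. -/
theorem generic_not (r : ℕ) (P : List ℕ → Prop) :
    Generic r (fun l => ¬ P l) ↔ ¬ Generic r P := by
  induction r generalizing P with
  | zero => rfl
  | succ r ih =>
    simp only [Generic]
    rw [← Ultrafilter.eventually_not]
    exact Filter.eventually_congr (Filter.Eventually.of_forall fun j => ih _)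

/-- Ramsey's theorem for finitely many generic properties of tuples. -/
theorem exists_homogeneous_list (n : ℕ) (N : ℕ) (F : List (ℕ × (List ℕ → Prop)))
    (hF : ∀ p ∈ F, Generic p.1 p.2) :
    ∃ l : List ℕ, l.length = n ∧ l.Pairwise (· < ·) ∧ (∀ a ∈ l, N < a) ∧
      ∀ p ∈ F, ∀ l', l'.Sublist l → l'.length = p.1 → p.2 l' := by
  induction n generalizing N F with
  | zero =>
    refine ⟨[], rfl, List.Pairwise.nil, by simp, ?_⟩
    rintro ⟨r, P⟩ hp l' hl' hlen
    obtain rfl := List.sublist_nil.1 hl'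
    obtain rfl : 0 = r := hlen
    exact hF _ hp
  | succ n ih =>
    have h1 : ∀ᶠ j in (Filter.hyperfilter ℕ : Filter ℕ), ∀ p ∈ {p | p ∈ F},
        ∀ r, p.1 = r + 1 → Generic r fun l => p.2 (j :: l) := by
      rw [Filter.eventually_all_finite (List.finite_toSet F)]
      rintro ⟨r, P⟩ hp
      cases r with
      | zero => exact Filter.Eventually.of_forall fun j r hr => by simp at hr
      | succ r =>
        filter_upwards [hF _ hp] with j hj r' hr'
        obtain rfl : r = r' := by simpa using hr'
        exact hj
    have h2 : ∀ᶠ j in (Filter.hyperfilter ℕ : Filter ℕ), N < j :=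
      Nat.hyperfilter_le_atTop (Filter.eventually_gt_atTop N)
    obtain ⟨j, hj, hNj⟩ := (h1.and h2).exists
    -- With the first entry fixed as `j`, a property of `r + 1` entries leaves a generic property of
    -- `r` entries. `F` itself is kept for the sublists that avoid `j`.
    let shift : ℕ × (List ℕ → Prop) → ℕ × (List ℕ → Prop) := fun p =>
      if p.1 = 0 then p else (p.1 - 1, fun l => p.2 (j :: l))
    obtain ⟨l, hlen, hsort, hlt, hl⟩ := ih j (F ++ F.map shift) (by
      intro p hp
      rcases List.mem_append.1 hp with hp | hp
      · exact hF p hp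
      · obtain ⟨q, hq, rfl⟩ := List.mem_map.1 hp
        by_cases h0 : q.1 = 0
        · have := hF q hq
          simp only [shift, h0, if_true]
          rwa [← h0]
        · simp only [shift, h0, if_false]
          exact hj q hq _ (by omega))
    refine ⟨j :: l, by simp [hlen], List.pairwise_cons.2 ⟨hlt, hsort⟩, ?_, ?_⟩
    · intro a ha
      rcases List.mem_cons.1 ha with rfl | ha
      · exact hNj
      · exact hNj.trans (hlt a ha)
    · intro p hp l' hl' hlen'
      rcases List.sublist_cons_iff.1 hl' with h | ⟨r, rfl, hr⟩
      · exact hl p (List.mem_append_left _ hp) l' h hlen'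
      · have h0 : p.1 ≠ 0 := by simp at hlen'; omega
        have := hl (shift p) (List.mem_append_right _ (List.mem_map_of_mem hp)) r hr
          (by simp only [shift, h0, if_false]; simp at hlen'; omega)
        simpa only [shift, h0, if_false] using this

variable {Λ : Type*} [LinearOrder Λ]

/-- `Q g` holds for generic `g : Λ → ℕ`, where `Q g` depends only on the restriction of `g` to the
finite set `s`. -/
def GenericOn (s : Finset Λ) (Q : (Λ → ℕ) → Prop) : Prop :=
  Generic s.card fun l => ∃ g : Λ → ℕ, l = s.sort.map g ∧ Q g

/-- Ramsey's theorem for finitely many properties of functions on finite subsets of a linear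
order. -/
theorem exists_homogeneous_map {ι : Type*} (F : Finset ι) (s : ι → Finset Λ)
    (Q : ι → (Λ → ℕ) → Prop)
    (hQ : ∀ k g g', (∀ a ∈ s k, g a = g' a) → Q k g → Q k g') (B : Finset Λ) :
    ∃ h : Λ → ℕ, StrictMonoOn h B ∧ ∀ k ∈ F, ∀ e : Λ → Λ, StrictMonoOn e (s k) →
      (∀ a ∈ s k, e a ∈ B) → (Q k (h ∘ e) ↔ GenericOn (s k) (Q k)) := by
  classical
  let P : ι → List ℕ → Prop := fun k l => ∃ g : Λ → ℕ, l = (s k).sort.map g ∧ Q k g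
  have hP : ∀ k g, P k ((s k).sort.map g) ↔ Q k g := by
    intro k g
    refine ⟨?_, fun h => ⟨g, rfl, h⟩⟩
    rintro ⟨g', hg, h⟩
    rw [List.map_inj_left] at hg
    exact hQ k g' g (fun a ha => (hg a ((Finset.mem_sort _).2 ha)).symm) h
  -- Of each property and its negation, the generic one is requested.
  obtain ⟨l, hlen, hsort, -, hl⟩ := exists_homogeneous_list B.card 0
    (F.toList.map fun k => ((s k).card,
      if Generic (s k).card (P k) then P k else fun l => ¬ P k l)) (by
      intro p hp
      obtain ⟨k, -, rfl⟩ := List.mem_map.1 hp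
      by_cases h : Generic (s k).card (P k)
      · simp [h]
      · simp only [h, if_false]
        exact (generic_not _ _).2 h)
  have hBlen : B.sort.length = l.length := by rw [Finset.length_sort, hlen]
  -- `h` sends the increasing enumeration of `B` to `l`; the default `0` occurs only outside `B`.
  let h : Λ → ℕ := fun a => l.getD (B.sort.idxOf a) 0
  have hmap : B.sort.map h = l := by
    apply List.ext_getElem (by simp [hlen])
    intro i h1 h2
    have h3 : i < B.sort.length := by simpa using h1
    rw [List.getElem_map]
    simp only [h]
    rw [(B.sort_nodup (· ≤ ·)).idxOf_getElem i h3, List.getD_eq_getElem _ _ h2]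
  refine ⟨h, ?_, ?_⟩
  · intro a ha b hb hab
    have ha' : a ∈ B.sort := (Finset.mem_sort _).2 ha
    have hb' : b ∈ B.sort := (Finset.mem_sort _).2 hb
    obtain ⟨i, hi, rfl⟩ := List.getElem_of_mem ha'
    obtain ⟨j, hj, rfl⟩ := List.getElem_of_mem hb'
    have hij : i < j := by
      by_contra hcon
      rcases (not_lt.1 hcon).eq_or_lt with rfl | hji
      · exact lt_irrefl _ hab
      · exact absurd hab (not_lt.2
          (List.pairwise_iff_getElem.1 (B.pairwise_sort (· ≤ ·)) j i hj hi hji))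
    have e : ∀ (i : ℕ) (hi : i < B.sort.length), h (B.sort[i]) = l[i]'(hBlen ▸ hi) := by
      intro i hi
      simp only [h]
      rw [(B.sort_nodup (· ≤ ·)).idxOf_getElem i hi, List.getD_eq_getElem]
    rw [e i hi, e j hj]
    exact List.pairwise_iff_getElem.1 hsort i j _ _ hij
  · intro k hk e he heB
    have hsub : ((s k).sort.map (h ∘ e)).Sublist l := by
      rw [← hmap, ← List.map_map]
      apply List.Sublist.map
      have hp : ((s k).sort.map e).Pairwise (· < ·) := by
        rw [List.pairwise_map]
        have := Finset.sortedLT_sort (s k)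
        refine List.Pairwise.imp_of_mem ?_ this.pairwise
        intro a b ha hb hab
        exact he ((Finset.mem_sort _).1 ha) ((Finset.mem_sort _).1 hb) hab
      apply List.sublist_of_subperm_of_pairwise (r := (· ≤ ·)) _ (hp.imp le_of_lt)
        (B.pairwise_sort (· ≤ ·))
      apply List.Nodup.subperm (hp.imp ne_of_lt)
      intro a ha
      obtain ⟨b, hb, rfl⟩ := List.mem_map.1 ha
      exact (Finset.mem_sort _).2 (heB b ((Finset.mem_sort _).1 hb))
    have := hl _ (List.mem_map_of_mem (Finset.mem_toList.2 hk)) _ hsub (by simp)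
    rw [← hP k]
    by_cases hG : Generic (s k).card (P k)
    · simp only [hG, if_true] at this
      exact ⟨fun _ => hG, fun _ => this⟩
    · simp only [hG, if_false] at this
      exact ⟨fun h => absurd h this, fun h => absurd h hG⟩

end Ramsey

/-! ### Grids of boxes and the splitting of columns -/

section Grid

variable {I X Y : Type*} (R : I → ℕ → X → Y → Prop)

/-- Some `y` lies, for every column `j` in the support of `f`, in the box number `σ j` of column `j`,
that is, `R j · x y` changes its truth value between the ends of the box. -/
def Meets (f : I →₀ ℕ) (g : I ×ₗ ℕ → ℕ) (σ : I → ℕ) (x : X) : Prop :=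
  ∃ y, ∀ j ∈ f.support, ¬ R j (g (toLex (j, 2 * σ j))) x y ∧ R j (g (toLex (j, 2 * σ j + 1))) x y

/-- Some `x` meets all combinations of boxes, where column `j` has `f j` boxes. -/
def HasGrid (f : I →₀ ℕ) (g : I ×ₗ ℕ → ℕ) : Prop :=
  ∃ x, ∀ σ : I → ℕ, (∀ j ∈ f.support, σ j < f j) → Meets R f g σ x

/-- `x` meets all combinations of boxes that use the box number `0` of column `i`. -/
def MeetsSlice (f : I →₀ ℕ) (i : I) (g : I ×ₗ ℕ → ℕ) (x : X) : Prop :=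
  ∀ σ : I → ℕ, (∀ j ∈ f.support, σ j < f j) → σ i = 0 → Meets R f g σ x

open Classical in
/-- The places of the ends of the boxes. -/
noncomputable def boxEnds (f : I →₀ ℕ) : Finset (I ×ₗ ℕ) :=
  f.support.biUnion fun j => (Finset.range (2 * f j)).image fun p => toLex (j, p)

theorem mem_boxEnds {f : I →₀ ℕ} {j : I} {p : ℕ} : toLex (j, p) ∈ boxEnds f ↔ p < 2 * f j := by
  classical
  simp only [boxEnds, Finset.mem_biUnion, Finset.mem_image, Finset.mem_range, Finsupp.mem_support_iff]
  constructor
  · rintro ⟨j', -, p', hp', h⟩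
    obtain ⟨rfl, rfl⟩ := Prod.mk.inj (toLex.injective h)
    exact hp'
  · intro h
    exact ⟨j, by omega, p, h, rfl⟩

/-- The map on places that acts on column `j` by `u j`. -/
def columnMap (u : I → ℕ → ℕ) (a : I ×ₗ ℕ) : I ×ₗ ℕ :=
  toLex ((ofLex a).1, u (ofLex a).1 (ofLex a).2)

@[simp]
theorem columnMap_toLex (u : I → ℕ → ℕ) (j : I) (p : ℕ) :
    columnMap u (toLex (j, p)) = toLex (j, u j p) := rfl

variable {R}

/-- The same `y` works after boxes are enlarged or columns dropped, because truth in each column is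
monotone in the index. -/
theorem Meets.mono (hR : ∀ i x y, Monotone fun p => R i p x y) {f F : I →₀ ℕ}
    {g g' : I ×ₗ ℕ → ℕ} {σ σ' : I → ℕ} {x : X} (h : Meets R F g' σ' x)
    (hs : f.support ⊆ F.support)
    (hl : ∀ j ∈ f.support, g (toLex (j, 2 * σ j)) ≤ g' (toLex (j, 2 * σ' j)))
    (hr : ∀ j ∈ f.support, g' (toLex (j, 2 * σ' j + 1)) ≤ g (toLex (j, 2 * σ j + 1))) :
    Meets R f g σ x := by
  obtain ⟨y, hy⟩ := h
  exact ⟨y, fun j hj => ⟨fun h => (hy j (hs hj)).1 (hR j x y (hl j hj) h),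
    hR j x y (hr j hj) (hy j (hs hj)).2⟩⟩

theorem Meets.congr {f : I →₀ ℕ} {g g' : I ×ₗ ℕ → ℕ} {σ : I → ℕ} {x : X}
    (hσ : ∀ j ∈ f.support, σ j < f j) (h : ∀ a ∈ boxEnds f, g a = g' a) (hg : Meets R f g σ x) :
    Meets R f g' σ x := by
  obtain ⟨y, hy⟩ := hg
  refine ⟨y, fun j hj => ?_⟩
  have := hσ j hj
  rw [← h _ (mem_boxEnds.2 (by omega)), ← h _ (mem_boxEnds.2 (by omega))]
  exact hy j hj

variable (R) [LinearOrder I]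

/-- For generic choices of the boxes there is a grid. -/
def Good (f : I →₀ ℕ) : Prop := GenericOn (boxEnds f) (HasGrid R f)

theorem columnMap_strictMono {u : I → ℕ → ℕ} (hu : ∀ j, StrictMono (u j)) :
    StrictMono (columnMap u) := by
  intro a b hab
  rw [Prod.Lex.lt_iff] at hab ⊢
  rcases hab with h | ⟨h1, h2⟩
  · exact Or.inl h
  · refine Or.inr ⟨h1, ?_⟩
    simp only [columnMap, ofLex_toLex]
    rw [← h1]
    exact hu _ h2

/-- Provides a window of `K` places per column in which boxes may be moved freely, the existence of
a grid depending only on its shape. -/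
theorem exists_homogeneous_columns (T : Finset (I →₀ ℕ)) (J : Finset I) (K : ℕ) :
    ∃ h : I ×ₗ ℕ → ℕ, (∀ j ∈ J, ∀ p q, p ≤ q → q < K → h (toLex (j, p)) ≤ h (toLex (j, q))) ∧
      (∀ j ∈ J, ∀ p q, p < q → q < K → h (toLex (j, p)) < h (toLex (j, q))) ∧
      ∀ f ∈ T, f.support ⊆ J → ∀ u : I → ℕ → ℕ, (∀ j, StrictMono (u j)) →
        (∀ j ∈ J, ∀ p < 2 * f j, u j p < K) → (HasGrid R f (h ∘ columnMap u) ↔ Good R f) := by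
  classical
  let B : Finset (I ×ₗ ℕ) := J.biUnion fun j => (Finset.range K).image fun p => toLex (j, p)
  have hB : ∀ j ∈ J, ∀ p < K, toLex (j, p) ∈ B := fun j hj p hp =>
    Finset.mem_biUnion.2 ⟨j, hj, Finset.mem_image.2 ⟨p, Finset.mem_range.2 hp, rfl⟩⟩
  obtain ⟨h, hmono, hh⟩ := exists_homogeneous_map T boxEnds (HasGrid R) (by
    rintro f g g' hgg ⟨x, hx⟩
    exact ⟨x, fun σ hσ => (hx σ hσ).congr hσ hgg⟩) B
  have hlt : ∀ j ∈ J, ∀ p q, p < q → q < K → h (toLex (j, p)) < h (toLex (j, q)) := by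
    intro j hj p q hpq hq
    exact hmono (hB j hj p (hpq.trans hq)) (hB j hj q hq)
      (Prod.Lex.toLex_lt_toLex.2 (Or.inr ⟨rfl, hpq⟩))
  refine ⟨h, ?_, hlt, ?_⟩
  · intro j hj p q hpq hq
    rcases hpq.eq_or_lt with rfl | hpq
    · exact le_rfl
    · exact (hlt j hj p q hpq hq).le
  · intro f hf hfJ u hu huK
    refine hh f hf _ ((columnMap_strictMono hu).strictMonoOn _) ?_
    intro a ha
    obtain ⟨⟨j, p⟩, rfl⟩ := toLex.surjective a
    have hp := mem_boxEnds.1 ha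
    have hj : j ∈ J := hfJ (Finsupp.mem_support_iff.2 (by omega))
    exact hB j hj _ (huK j hj p hp)

/-- With at most one box per column a single `y` suffices: place each cut at the right end of the
box. -/
theorem good_of_le_one
    (hfull : ∀ (η : I → ℕ) (s : Finset (I × ℕ)), ∃ x y, ∀ p ∈ s, R p.1 p.2 x y ↔ η p.1 ≤ p.2)
    {f : I →₀ ℕ} (hf : ∀ i, f i ≤ 1) : Good R f := by
  classical
  obtain ⟨h, -, hlt, hh⟩ := exists_homogeneous_columns R {f} f.support 2
  rw [← hh f (Finset.mem_singleton_self f) subset_rfl (fun _ p => p) (fun _ => strictMono_id)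
    (fun j _ p hp => by have := hf j; omega)]
  let r : I → ℕ → ℕ := fun j p => h (toLex (j, p))
  obtain ⟨x, y, hxy⟩ := hfull (fun j => r j 1)
    (f.support.image (fun j => (j, r j 0)) ∪ f.support.image fun j => (j, r j 1))
  refine ⟨x, fun σ hσ => ⟨y, fun j hj => ?_⟩⟩
  have h0 : σ j = 0 := by have := hσ j hj; have := hf j; omega
  have h1 := hxy (j, r j 0) (Finset.mem_union_left _ (Finset.mem_image_of_mem _ hj))
  have h2 := hxy (j, r j 1) (Finset.mem_union_right _ (Finset.mem_image_of_mem _ hj))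
  have h3 : r j 0 < r j 1 := hlt j hj 0 1 one_pos (by norm_num)
  simp only [Function.comp_apply, columnMap_toLex, h0]
  exact ⟨fun h => absurd (h1.1 h) (not_le.2 h3), h2.2 le_rfl⟩

/-- Generic grids of all finite sizes on a set of columns give the finite parts of a pattern. -/
theorem exists_fiber_pattern (hR : ∀ i x y, Monotone fun p => R i p x y) (J : Finset I) (c : ℕ)
    {f : I →₀ ℕ} (hfJ : f.support = J) (hf : ∀ j ∈ J, f j = c + 1) (hgood : Good R f) :
    ∃ (x : X) (q : I → ℕ → ℕ), (∀ j ∈ J, ∀ t, t + 1 < c → q j t ≤ q j (t + 1)) ∧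
      ∀ η : I → ℕ, (∀ j, η j ≤ c) → ∃ y, ∀ j ∈ J, ∀ t < c, R j (q j t) x y ↔ η j ≤ t := by
  obtain ⟨h, hle, -, hh⟩ := exists_homogeneous_columns R {f} J (2 * (c + 1))
  obtain ⟨x, hx⟩ := (hh f (Finset.mem_singleton_self f) hfJ.subset (fun _ p => p)
    (fun _ => strictMono_id) (fun j hj p hp => by rwa [hf j hj] at hp)).2 hgood
  -- The chain consists of right ends of boxes: a `y` in box `η j` satisfies `R` at exactly those
  -- right ends with `η j ≤ t`. The `c + 1` values of `η j` need `c + 1` boxes.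
  refine ⟨x, fun j t => h (toLex (j, 2 * t + 1)), ?_, ?_⟩
  · intro j hj t ht
    exact hle j hj _ _ (by omega) (by omega)
  · intro η hη
    obtain ⟨y, hy⟩ := hx η (fun j hj => by rw [hf j (hfJ ▸ hj)]; have := hη j; omega)
    refine ⟨y, fun j hj t ht => ?_⟩
    obtain ⟨h1, h2⟩ := hy j (hfJ ▸ hj)
    have := hη j
    simp only [Function.comp_apply, columnMap_toLex] at h1 h2
    constructor
    · intro h3
      by_contra hcon
      exact h1 (hR j x y (hle j hj _ _ (by omega) (by omega)) h3)
    · intro h3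
      exact hR j x y (hle j hj _ _ (by omega) (by omega)) h2

/-- The places `a, b, r + 2, r + 3, …`. -/
def placeBox (r a b p : ℕ) : ℕ := if p = 0 then a else if p = 1 then b else r + p

theorem placeBox_strictMono {r a b : ℕ} (hab : a < b) (hb : b < r + 2) :
    StrictMono (placeBox r a b) := by
  refine strictMono_nat_of_lt_succ fun p => ?_
  rcases p with _ | _ | p <;> simp [placeBox] <;> omega

/-- The places `a, b, a', b', r + 2, r + 3, …`. -/
def placeTwoBoxes (r a b a' b' p : ℕ) : ℕ :=
  if p < 2 then placeBox r a b p else placeBox r a' b' (p - 2)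

theorem placeTwoBoxes_strictMono {r a b a' b' : ℕ} (hab : a < b) (hb : b < a') (hab' : a' < b')
    (hb' : b' < r + 2) : StrictMono (placeTwoBoxes r a b a' b') := by
  refine strictMono_nat_of_lt_succ fun p => ?_
  rcases p with _ | _ | _ | _ | p <;> simp [placeTwoBoxes, placeBox] <;> omega

/-- If generic grids of shape `F` exist, but adding a box in column `i` is generically impossible
(for each `i` in a finite set `J`), then the existence of the added box is an `x`-condition that
cuts column `i`, and all combinations of cuts occur. -/
theorem exists_slice_pattern (hR : ∀ i x y, Monotone fun p => R i p x y) (J : Finset I) (c : ℕ)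
    {F : I →₀ ℕ} (hF : Good R F) {f : I → I →₀ ℕ} (hf : ∀ i ∈ J, ¬ Good R (f i))
    (hfi : ∀ i ∈ J, f i i = F i + 1) (hfj : ∀ i ∈ J, ∀ j ≠ i, f i j ≤ F j)
    (hpos : ∀ i ∈ J, 0 < F i) :
    ∃ g : I → ℕ → I ×ₗ ℕ → ℕ,
      (∀ i ∈ J, ∀ t, t + 1 < c → ∀ x, MeetsSlice R (f i) i (g i t) x →
        MeetsSlice R (f i) i (g i (t + 1)) x) ∧
      ∀ η : I → ℕ, (∀ j, η j ≤ c) → ∃ x, ∀ i ∈ J, ∀ t < c,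
        MeetsSlice R (f i) i (g i t) x ↔ η i ≤ t := by
  classical
  have hsupp : ∀ i ∈ J, (f i).support ⊆ F.support := by
    intro i hi j hj
    rw [Finsupp.mem_support_iff] at hj ⊢
    by_cases hji : j = i
    · subst hji
      exact (hpos j hi).ne'
    · have := hfj i hi j hji
      omega
  -- Places up to `r` are for the movable boxes, from `3 * η j + 1` to `3 * η j + 2`, and the test
  -- boxes; all further boxes sit at `r + 2, r + 3, …`.
  set r : ℕ := 3 * c + 3 with hr
  set K : ℕ := r + 2 * (∑ j ∈ F.support, F j) + 2 with hK
  have hFsum : ∀ j ∈ F.support, F j ≤ ∑ j ∈ F.support, F j := fun j hj =>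
    Finset.single_le_sum (f := fun j => F j) (fun _ _ => Nat.zero_le _) hj
  obtain ⟨h, hle, -, hh⟩ := exists_homogeneous_columns R (insert F (J.image f)) F.support K
  -- The test box in column `i` runs from `0` to `3 * t + 3`. In other columns box `0` runs from `0`
  -- to `r`, so it contains the movable box wherever that is.
  let w : I → ℕ → I → ℕ → ℕ := fun i t j =>
    if j = i then placeBox r 0 (3 * t + 3) else placeBox r 0 r
  refine ⟨fun i t => h ∘ columnMap (w i t), ?_, ?_⟩
  · intro i hi t ht x hx σ hσ hσi
    refine (hx σ hσ hσi).mono hR subset_rfl ?_ ?_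
    all_goals
      intro j hj
      have hjF := hsupp i hi hj
      have h1 := hσ j hj
      have h2 : f i j ≤ F j + 1 := by
        by_cases hji : j = i
        · subst hji
          exact (hfi j hi).le
        · exact (hfj i hi j hji).trans (Nat.le_succ _)
      have h3 := hFsum j hjF
      simp only [Function.comp_apply, columnMap_toLex]
      refine hle j hjF _ _ ?_ ?_
    all_goals
      simp only [w]
      split_ifs <;> unfold placeBox <;> split_ifs <;> omega
  · intro η hη
    obtain ⟨x, hx⟩ := (hh F (Finset.mem_insert_self _ _) subset_rfl
      (fun j => placeBox r (3 * η j + 1) (3 * η j + 2))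
      (fun j => placeBox_strictMono (by omega) (by have := hη j; omega))
      (fun j hj p hp => by
        have := hη j
        have := hFsum j hj
        unfold placeBox
        split_ifs <;> omega)).2 hF
    refine ⟨x, fun i hi t ht => ⟨fun hslice => ?_, fun hηt => ?_⟩⟩
    · by_contra hcon
      -- If `t < η i`, the test box lies left of the movable box. Both together with the far boxes
      -- would form a grid of the bad shape `f i`.
      refine hf i hi ((hh (f i) (Finset.mem_insert_of_mem (Finset.mem_image_of_mem _ hi))
        (hsupp i hi) (fun j => if j = i then
          placeTwoBoxes r 0 (3 * t + 3) (3 * η j + 1) (3 * η j + 2) else placeBox r 0 r)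
        ?_ ?_).1 ⟨x, fun σ hσ => ?_⟩)
      · intro j
        have := hη j
        by_cases hji : j = i
        · subst hji
          simp only [if_true]
          exact placeTwoBoxes_strictMono (by omega) (by omega) (by omega) (by omega)
        · simp only [hji, if_false]
          exact placeBox_strictMono (by omega) (by omega)
      · intro j hj p hp
        have := hη j
        have := hFsum j hj
        by_cases hji : j = i
        · subst hji
          have := hfi j hi
          simp only [if_true]
          unfold placeTwoBoxes placeBox
          split_ifs <;> omega
        · have := hfj i hi j hji
          simp only [hji, if_false]
          unfold placeBox
          split_ifs <;> omega
      · by_cases hσi : σ i = 0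
        · refine (hslice σ hσ hσi).mono hR subset_rfl ?_ ?_
          all_goals
            intro j hj
            refine le_of_eq ?_
            by_cases hji : j = i
            · subst hji
              simp [w, hσi, placeTwoBoxes]
            · simp [w, hji]
        -- Combinations avoiding the test box come from the grid of shape `F`, where box numbers in
        -- column `i` drop by one. Columns outside the support of `f i` may use box `0`.
        · refine (hx (fun j => if j ∈ (f i).support then if j = i then σ j - 1 else σ j else 0)
            ?_).mono hR (hsupp i hi) ?_ ?_
          · intro j hj
            by_cases hjf : j ∈ (f i).support
            · have h1 := hσ j hjf
              simp only [hjf, if_true]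
              by_cases hji : j = i
              · subst hji
                have := hfi j hi
                simp only [if_true]
                omega
              · have := hfj i hi j hji
                simp only [hji, if_false]
                omega
            · simp only [hjf, if_false]
              exact Nat.pos_of_ne_zero (Finsupp.mem_support_iff.1 hj)
          all_goals
            intro j hj
            have hjF := hsupp i hi hj
            have h1 := hσ j hj
            have h3 := hFsum j hjF
            have h4 := hη j
            simp only [Function.comp_apply, columnMap_toLex, hj, if_true]
            by_cases hji : j = i
            · subst hji
              have h5 := hfi j hi
              simp only [if_true]
              refine hle j hjF _ _ ?_ ?_ <;> simp only [placeTwoBoxes, placeBox] <;> split_ifs <;> omega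
            · have h5 := hfj i hi j hji
              simp only [hji, if_false]
              refine hle j hjF _ _ ?_ ?_ <;> unfold placeBox <;> split_ifs <;> first | contradiction | omega
    · intro σ hσ hσi
      -- If `η i ≤ t`, the test box contains the movable box, so the grid of shape `F` already meets
      -- the slice.
      refine (hx (fun j => if j ∈ (f i).support then σ j else 0) ?_).mono hR (hsupp i hi) ?_ ?_
      · intro j hj
        by_cases hjf : j ∈ (f i).support
        · have h1 := hσ j hjf
          simp only [hjf, if_true]
          by_cases hji : j = i
          · subst hji
            rw [hσi]
            exact hpos j hi
          · have := hfj i hi j hji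
            omega
        · simp only [hjf, if_false]
          exact Nat.pos_of_ne_zero (Finsupp.mem_support_iff.1 hj)
      all_goals
        intro j hj
        have hjF := hsupp i hi hj
        have h1 := hσ j hj
        have h3 := hFsum j hjF
        have h4 := hη j
        simp only [Function.comp_apply, columnMap_toLex, hj, if_true, w]
        by_cases hji : j = i
        · subst hji
          simp only [if_true, hσi]
          refine hle j hjF _ _ ?_ ?_ <;> simp [placeBox] <;> omega
        · have h5 := hfj i hi j hji
          simp only [hji, if_false]
          refine hle j hjF _ _ ?_ ?_ <;> unfold placeBox <;> split_ifs <;> first | contradiction | omega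

/-- A family of independent cuts in the product `X × Y` splits into columns for which there are
independent cuts in `Y` over a parameter from `X`, and columns for which there are independent cuts
in `X`. -/
theorem exists_split (hR : ∀ i x y, Monotone fun p => R i p x y)
    (hfull : ∀ (η : I → ℕ) (s : Finset (I × ℕ)), ∃ x y, ∀ p ∈ s, R p.1 p.2 x y ↔ η p.1 ≤ p.2) :
    ∃ S : Set I,
      (∀ (J : Finset I), (J : Set I) ⊆ S → ∀ c : ℕ, ∃ (x : X) (q : I → ℕ → ℕ),
        (∀ j ∈ J, ∀ t, t + 1 < c → q j t ≤ q j (t + 1)) ∧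
        ∀ η : I → ℕ, (∀ j, η j ≤ c) → ∃ y, ∀ j ∈ J, ∀ t < c, R j (q j t) x y ↔ η j ≤ t) ∧
      ∃ f : I → I →₀ ℕ, ∀ (J : Finset I), (J : Set I) ⊆ Sᶜ → ∀ c : ℕ,
        ∃ g : I → ℕ → I ×ₗ ℕ → ℕ,
          (∀ i ∈ J, ∀ t, t + 1 < c → ∀ x, MeetsSlice R (f i) i (g i t) x →
            MeetsSlice R (f i) i (g i (t + 1)) x) ∧
          ∀ η : I → ℕ, (∀ j, η j ≤ c) → ∃ x, ∀ i ∈ J, ∀ t < c,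
            MeetsSlice R (f i) i (g i t) x ↔ η i ≤ t := by
  classical
  -- Each `f` has finite support, so below the supremum of a chain it is already below a member;
  -- hence upper bounds exist.
  obtain ⟨N, hN1, hN, hmax⟩ := zorn_le_nonempty₀
    {N : I → ℕ∞ | ∀ f : I →₀ ℕ, (∀ i, (f i : ℕ∞) ≤ N i) → Good R f} (by
      intro C hC hchain N₀ hN₀
      refine ⟨fun i => ⨆ M ∈ C, M i, ?_, fun M hM i => le_iSup₂_of_le M hM le_rfl⟩
      intro f hf
      have key : ∀ J : Finset I, ∃ M ∈ C, ∀ i ∈ J, (f i : ℕ∞) ≤ M i := by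
        intro J
        induction J using Finset.induction_on with
        | empty => exact ⟨N₀, hN₀, by simp⟩
        | insert i J _ ih =>
          obtain ⟨M, hM, hMJ⟩ := ih
          have : ∃ M' ∈ C, (f i : ℕ∞) ≤ M' i := by
            by_contra! hcon
            rcases Nat.eq_zero_or_pos (f i) with h0 | h0
            · have := hcon N₀ hN₀
              simp [h0] at this
            · have h1 : ⨆ M ∈ C, M i ≤ ((f i - 1 : ℕ) : ℕ∞) := by
                refine iSup₂_le fun M' hM' => ?_
                have := hcon M' hM'
                rw [← Nat.sub_add_cancel h0] at this
                push_cast at this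
                exact ENat.lt_add_one_iff (by simp) |>.1 (by simpa using this)
              have h2 : ((f i : ℕ) : ℕ∞) ≤ ((f i - 1 : ℕ) : ℕ∞) := (hf i).trans h1
              have h3 : f i ≤ f i - 1 := by exact_mod_cast h2
              omega
          obtain ⟨M', hM', hi⟩ := this
          rcases hchain.total hM hM' with h | h
          · refine ⟨M', hM', fun j hj => ?_⟩
            rcases Finset.mem_insert.1 hj with rfl | hj
            · exact hi
            · exact (hMJ j hj).trans (h j)
          · refine ⟨M, hM, fun j hj => ?_⟩
            rcases Finset.mem_insert.1 hj with rfl | hj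
            · exact hi.trans (h j)
            · exact hMJ j hj
      obtain ⟨M, hM, hMf⟩ := key f.support
      refine hC hM f fun i => ?_
      by_cases hi : i ∈ f.support
      · exact hMf i hi
      · simp [Finsupp.notMem_support_iff.1 hi]) (fun _ => 1)
    (fun f hf => good_of_le_one R hfull fun i => by
      have h : (f i : ℕ∞) ≤ 1 := hf i
      exact_mod_cast h)
  refine ⟨{i | N i = ⊤}, ?_, ?_⟩
  · intro J hJ c
    refine exists_fiber_pattern R hR J c
      (f := Finsupp.onFinset J (fun j => if j ∈ J then c + 1 else 0) (by simp)) ?_ ?_ (hN _ ?_)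
    · ext j
      simp
    · intro j hj
      simp [hj]
    · intro j
      by_cases hj : j ∈ J
      · have : N j = ⊤ := hJ hj
        simp [this]
      · simp [hj]
  · have hbad : ∀ i, ∃ f : I →₀ ℕ, N i ≠ ⊤ → ¬ Good R f ∧ f i = (N i).toNat + 1 ∧
        ∀ j ≠ i, (f j : ℕ∞) ≤ N j := by
      intro i
      by_cases hi : N i = ⊤
      · exact ⟨0, fun h => absurd hi h⟩
      -- By maximality `N` cannot be raised by one at `i`. A bad shape witnessing this must use the
      -- new box, so its value at `i` is exactly `N i + 1`.
      have hnot : ¬ ∀ f : I →₀ ℕ,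
          (∀ j, (f j : ℕ∞) ≤ Function.update N i (N i + 1) j) → Good R f := by
        intro hcon
        have h1 := hmax hcon (by
          intro j
          by_cases hj : j = i
          · subst hj
            simp
          · simp [hj]) i
        simp only [Function.update_self] at h1
        exact absurd h1 (not_le.2 (ENat.lt_add_one_iff hi |>.2 le_rfl))
      push Not at hnot
      obtain ⟨f, hf, hgood⟩ := hnot
      have hfj : ∀ j ≠ i, (f j : ℕ∞) ≤ N j := fun j hj => by simpa [hj] using hf j
      refine ⟨f, fun _ => ⟨hgood, ?_, hfj⟩⟩
      have h1 : (f i : ℕ∞) ≤ N i + 1 := by simpa using hf i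
      have h2 : ¬ (f i : ℕ∞) ≤ N i := by
        intro h
        refine hgood (hN f fun j => ?_)
        by_cases hj : j = i
        · subst hj
          exact h
        · exact hfj j hj
      rw [← ENat.natCast_toNat hi] at h1 h2
      norm_cast at h1 h2
      omega
    choose f hf using hbad
    refine ⟨f, fun J hJ c => ?_⟩
    have hJ' : ∀ i ∈ J, N i ≠ ⊤ := fun i hi => hJ hi
    let J' : Finset I := J ∪ J.biUnion fun i => (f i).support
    -- `F` must stay below `N` and dominate every `f i` off column `i`; where `N j = ⊤` the sum is a
    -- finite bound for all of them.
    let F : I →₀ ℕ := Finsupp.onFinset J'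
      (fun j => if j ∈ J' then if N j = ⊤ then ∑ i ∈ J, f i j else (N j).toNat else 0)
      (by intro j hj; by_contra h; simp [h] at hj)
    have hF : ∀ j ∈ J', F j = if N j = ⊤ then ∑ i ∈ J, f i j else (N j).toNat := fun j hj => by
      simp [F, hj]
    have hFJ : ∀ i ∈ J, F i = (N i).toNat := fun i hi => by
      rw [hF i (Finset.mem_union_left _ hi), if_neg (hJ' i hi)]
    refine exists_slice_pattern R hR J c (F := F) (hN F ?_) (fun i hi => (hf i (hJ' i hi)).1) ?_ ?_ ?_
    · intro j
      by_cases hj : j ∈ J'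
      · rw [hF j hj]
        split_ifs with h
        · simp [h]
        · rw [ENat.natCast_toNat h]
      · simp [F, hj]
    · intro i hi
      rw [hFJ i hi, (hf i (hJ' i hi)).2.1]
    · intro i hi j hj
      rcases Nat.eq_zero_or_pos (f i j) with h0 | h0
      · omega
      have hjJ : j ∈ J' := Finset.mem_union_right _
        (Finset.mem_biUnion.2 ⟨i, hi, Finsupp.mem_support_iff.2 h0.ne'⟩)
      rw [hF j hjJ]
      split_ifs with h
      · exact Finset.single_le_sum (f := fun i => f i j) (fun _ _ => Nat.zero_le _) hi
      · have := (hf i (hJ' i hi)).2.2 j hj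
        rw [← ENat.natCast_toNat h] at this
        exact_mod_cast this
    · intro i hi
      rw [hFJ i hi]
      have : 1 ≤ N i := hN1 i
      rw [← ENat.natCast_toNat (hJ' i hi)] at this
      have h1 : 1 ≤ (N i).toNat := by exact_mod_cast this
      exact h1

end Grid

/-! ### Compactness and definability of the slice condition -/

section Compactness

variable {L : FirstOrder.Language.{u, v}}

/-- Strictness is automatic: a solution for the cut at `j + 1` lies in the set with index `j + 1`
but not in the one with index `j`. -/
theorem IsPattern.of_subset {M : Type*} [L.Structure M] {I : Type*} {m : ℕ} {k : I → ℕ}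
    {φ : (i : I) → L.Formula (Fin m ⊕ Fin (k i))} {b : (i : I) → ℕ → Fin (k i) → M}
    (hcon : ∀ (η : I → ℕ) (s : Finset (I × ℕ)), ∃ a : Fin m → M,
      ∀ p ∈ s, a ∈ definedSet (φ p.1) (b p.1 p.2) ↔ η p.1 ≤ p.2)
    (hsub : ∀ i j, definedSet (φ i) (b i j) ⊆ definedSet (φ i) (b i (j + 1))) :
    IsPattern M φ b := by
  classical
  refine ⟨hcon, fun i j => ⟨hsub i j, fun h => ?_⟩⟩
  obtain ⟨a, ha⟩ := hcon (fun _ => j + 1) {(i, j), (i, j + 1)}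
  have h1 := ha (i, j) (by simp)
  have h2 := ha (i, j + 1) (by simp)
  have := h1.1 (h (h2.2 le_rfl))
  simp at this

/-- If all finite parts of a pattern exist in a model of `T`, then the pattern exists in an
ultrapower. -/
theorem hasPattern_of_forall_finite {T : L.Theory}
    (M : FirstOrder.Language.Theory.ModelType.{u, v, max u v} T) {I : Type (max u v)} {m : ℕ}
    {γ : I → Type*} [∀ i, Finite (γ i)] (φ : (i : I) → L.Formula (Fin m ⊕ γ i))
    (h : ∀ (J : Finset I) (c : ℕ), ∃ b : (i : I) → ℕ → γ i → M,
      (∀ i ∈ J, ∀ t, t + 1 < c → ∀ a : Fin m → M, (φ i).Realize (Sum.elim a (b i t)) →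
        (φ i).Realize (Sum.elim a (b i (t + 1)))) ∧
      ∀ η : I → ℕ, (∀ i, η i ≤ c) → ∃ a : Fin m → M, ∀ i ∈ J, ∀ t < c,
        (φ i).Realize (Sum.elim a (b i t)) ↔ η i ≤ t) :
    HasPattern T m #I := by
  classical
  choose b hb hη using h
  -- Almost every index contains any given column and exceeds any given depth.
  let D : Ultrafilter (Finset I × ℕ) := Ultrafilter.of Filter.atTop
  have hD : (D : Filter (Finset I × ℕ)) ≤ Filter.atTop := Ultrafilter.of_le _
  let N : Type (max u v) := (D : Filter (Finset I × ℕ)).Product fun _ => (M : Type (max u v))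
  have hN : N ⊨ T := by
    refine ⟨fun ψ hψ => ?_⟩
    exact (FirstOrder.Language.Ultraproduct.sentence_realize ψ).2
      (Filter.Eventually.of_forall fun _ => M.is_model.realize_of_mem ψ hψ)
  have hne : Nonempty N := FirstOrder.Language.Ultraproduct.Product.instNonempty
  let e : ∀ i, γ i ≃ Fin (Nat.card (γ i)) := fun i => Finite.equivFin (γ i)
  let mk : ((Finset I × ℕ) → M) → N := fun x =>
    (x : (D : Filter (Finset I × ℕ)).Product fun _ => (M : Type (max u v)))
  have hmk : Function.Surjective mk := fun x => Quotient.exists_rep x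
  let φ' : (i : I) → L.Formula (Fin m ⊕ Fin (Nat.card (γ i))) := fun i =>
    (φ i).relabel (Sum.map id (e i))
  let b' : (i : I) → ℕ → Fin (Nat.card (γ i)) → N := fun i t w =>
    mk fun p => b p.1 p.2 i t ((e i).symm w)
  have key : ∀ (i : I) (t : ℕ) (a : Fin m → (Finset I × ℕ) → M),
      (fun w => mk (a w)) ∈ definedSet (φ' i) (b' i t) ↔
        ∀ᶠ p in (D : Filter (Finset I × ℕ)),
          (φ i).Realize (Sum.elim (fun w => a w p) (b p.1 p.2 i t)) := by
    intro i t a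
    have h1 : (Sum.elim (fun w => mk (a w)) (b' i t)) ∘ Sum.map id (e i) =
        fun w => mk (Sum.elim a (fun z p => b p.1 p.2 i t z) w) := by
      funext w
      rcases w with w | w <;> simp [b']
    simp only [definedSet, Set.mem_ofPred_eq, φ', FirstOrder.Language.Formula.realize_relabel]
    rw [h1]
    refine (FirstOrder.Language.Ultraproduct.realize_formula_cast (φ i) _).trans ?_
    refine Filter.eventually_congr (Filter.Eventually.of_forall fun p => ?_)
    rw [iff_iff_eq]
    congr 1
    funext w
    rcases w with w | w <;> rfl
  refine ⟨FirstOrder.Language.Theory.ModelType.of T N, I, rfl, fun i => Nat.card (γ i), φ', b',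
    IsPattern.of_subset ?_ ?_⟩
  · intro η s
    let c₀ : ℕ := s.sup fun p => η p.1 + p.2 + 1
    have hc : ∀ p ∈ s, η p.1 + p.2 + 1 ≤ c₀ := fun p hp =>
      Finset.le_sup (f := fun p : I × ℕ => η p.1 + p.2 + 1) hp
    -- Cuts are truncated at the depth `p.2`; this changes nothing once `p.2 ≥ c₀`.
    choose a ha using fun p : Finset I × ℕ =>
      hη p.1 p.2 (fun i => min (η i) p.2) (fun i => min_le_right _ _)
    refine ⟨fun w => mk fun p => a p w, ?_⟩
    rintro ⟨i, t⟩ hs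
    refine (key i t fun w p => a p w).trans ?_
    have hev : ∀ᶠ p in (D : Filter (Finset I × ℕ)),
        ((φ i).Realize (Sum.elim (fun w => a p w) (b p.1 p.2 i t)) ↔ η i ≤ t) := by
      filter_upwards [hD (Filter.eventually_ge_atTop (({i}, c₀) : Finset I × ℕ))] with p hp
      have h1 : i ∈ p.1 := hp.1 (Finset.mem_singleton_self i)
      have h2 : c₀ ≤ p.2 := hp.2
      have h3 := hc _ hs
      simp only at h3
      refine (ha p i h1 t (by omega)).trans ?_
      rw [min_eq_left (by omega)]
    rw [Filter.eventually_congr hev, Filter.eventually_const]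
  · intro i t x hx
    choose a ha using fun w => hmk (x w)
    obtain rfl : (fun w => mk (a w)) = x := funext ha
    refine (key i (t + 1) a).2 ?_
    filter_upwards [(key i t a).1 hx,
      hD (Filter.eventually_ge_atTop (({i}, t + 2) : Finset I × ℕ))] with p hp hpt
    have h2 : t + 2 ≤ p.2 := hpt.2
    exact hb p.1 p.2 i (hpt.1 (Finset.mem_singleton_self i)) t (by omega) _ hp

/-- The formula expressing `MeetsSlice`. -/
theorem exists_formula_meetsSlice {M : Type*} [L.Structure M] {I : Type*} {m n : ℕ} {k : I → ℕ}
    (φ : (i : I) → L.Formula (Fin (m + n) ⊕ Fin (k i))) (b : (i : I) → ℕ → Fin (k i) → M)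
    (f : I →₀ ℕ) (i : I) :
    ∃ ψ : L.Formula (Fin m ⊕ Σ a : boxEnds f, Fin (k (ofLex a.1).1)),
      ∀ (g : I ×ₗ ℕ → ℕ) (x : Fin m → M),
        ψ.Realize (Sum.elim x fun a => b (ofLex a.1.1).1 (g a.1.1) a.2) ↔
          MeetsSlice (fun i p (x : Fin m → M) (y : Fin n → M) =>
            Fin.append x y ∈ definedSet (φ i) (b i p)) f i g x := by
  classical
  let A := Σ a : boxEnds f, Fin (k (ofLex a.1).1)
  -- Only the values of `σ` on the support matter, so there are finitely many combinations and the
  -- condition is a finite conjunction.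
  let Box := {σ : (j : f.support) → Fin (f j) // ∀ h : i ∈ f.support, (σ ⟨i, h⟩ : ℕ) = 0}
  let ρ : (a : boxEnds f) → Fin (m + n) ⊕ Fin (k (ofLex a.1).1) → (Fin m ⊕ A) ⊕ Fin n := fun a =>
    Sum.elim (Fin.append (fun w => Sum.inl (Sum.inl w)) Sum.inr)
      fun z => Sum.inl (Sum.inr ⟨a, z⟩)
  let θ : boxEnds f → L.Formula ((Fin m ⊕ A) ⊕ Fin n) := fun a => (φ (ofLex a.1).1).relabel (ρ a)
  let lo : Box → f.support → boxEnds f := fun σ j => ⟨toLex (j.1, 2 * (σ.1 j : ℕ)),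
    mem_boxEnds.2 (by have := (σ.1 j).2; omega)⟩
  let hi : Box → f.support → boxEnds f := fun σ j => ⟨toLex (j.1, 2 * (σ.1 j : ℕ) + 1),
    mem_boxEnds.2 (by have := (σ.1 j).2; omega)⟩
  have hθ : ∀ (a : boxEnds f) (g : I ×ₗ ℕ → ℕ) (x : Fin m → M) (y : Fin n → M),
      (θ a).Realize (Sum.elim (Sum.elim x fun a : A => b (ofLex a.1.1).1 (g a.1.1) a.2) y) ↔
        Fin.append x y ∈ definedSet (φ (ofLex a.1).1) (b (ofLex a.1).1 (g a.1)) := by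
    intro a g x y
    simp only [θ, definedSet, Set.mem_ofPred_eq, FirstOrder.Language.Formula.realize_relabel]
    rw [iff_iff_eq]
    congr 1
    funext w
    rcases w with w | w
    · refine Fin.addCases (fun w => ?_) (fun w => ?_) w <;> simp [ρ]
    · simp [ρ]
  refine ⟨FirstOrder.Language.Formula.iInf fun σ : Box =>
    FirstOrder.Language.Formula.iExs (Fin n) (FirstOrder.Language.Formula.iInf
      fun j : f.support => (θ (lo σ j)).not ⊓ θ (hi σ j)), fun g x => ?_⟩
  simp only [FirstOrder.Language.Formula.realize_iInf, FirstOrder.Language.Formula.realize_iExs,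
    FirstOrder.Language.Formula.realize_inf, FirstOrder.Language.Formula.realize_not]
  have hinner : ∀ (σ : Box) (y : Fin n → M), (∀ j : f.support,
      ¬ (θ (lo σ j)).Realize
        (Sum.elim (Sum.elim x fun a : A => b (ofLex a.1.1).1 (g a.1.1) a.2) y) ∧
      (θ (hi σ j)).Realize
        (Sum.elim (Sum.elim x fun a : A => b (ofLex a.1.1).1 (g a.1.1) a.2) y)) ↔
      ∀ j : f.support, Fin.append x y ∉ definedSet (φ j) (b j (g (toLex (j.1, 2 * (σ.1 j : ℕ))))) ∧
        Fin.append x y ∈ definedSet (φ j) (b j (g (toLex (j.1, 2 * (σ.1 j : ℕ) + 1)))) := by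
    intro σ y
    refine forall_congr' fun j => ?_
    rw [hθ, hθ]
    rfl
  constructor
  · intro h σ hσ hσi
    obtain ⟨y, hy⟩ := h ⟨fun j => ⟨σ j, hσ j j.2⟩, fun _ => hσi⟩
    rw [hinner] at hy
    exact ⟨y, fun j hj => hy ⟨j, hj⟩⟩
  · intro h σ
    obtain ⟨y, hy⟩ := h (fun j => if hj : j ∈ f.support then (σ.1 ⟨j, hj⟩ : ℕ) else 0)
      (fun j hj => by simp only [hj, dif_pos]; exact (σ.1 ⟨j, hj⟩).2)
      (by
        by_cases hi : i ∈ f.support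
        · simp only [hi, dif_pos]; exact σ.2 hi
        · simp only [hi, dif_neg, not_false_eq_true])
    refine ⟨y, ?_⟩
    rw [hinner]
    intro j
    have := hy j j.2
    simpa only [j.2, dif_pos] using this

end Compactness

/-! ### Splitting patterns -/

section Split

variable {L : FirstOrder.Language.{u, v}} {T : L.Theory}

/-- A pattern in `m + n` variables splits into a pattern in `m` variables and one in `n`
variables. -/
theorem HasPattern.split {m n : ℕ} {κ : Cardinal.{max u v}} (h : HasPattern T (m + n) κ) :
    ∃ κ₁ κ₂ : Cardinal.{max u v}, κ₁ + κ₂ = κ ∧ HasPattern T m κ₁ ∧ HasPattern T n κ₂ := by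
  classical
  obtain ⟨M, I, rfl, k, φ, b, hcon, hss⟩ := h
  let _ : LinearOrder I := linearOrderOfSTO WellOrderingRel
  obtain ⟨S, hS, f, hf⟩ := exists_split (fun i p (x : Fin m → M) (y : Fin n → M) =>
      Fin.append x y ∈ definedSet (φ i) (b i p))
    (fun i x y => monotone_nat_of_le_succ fun p h => (hss i p).1 h)
    (fun η s => by
      obtain ⟨a, ha⟩ := hcon η s
      refine ⟨fun w => a (Fin.castAdd n w), fun w => a (Fin.natAdd m w), ?_⟩
      have : Fin.append (fun w => a (Fin.castAdd n w)) (fun w => a (Fin.natAdd m w)) = a :=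
        Fin.append_castAdd_natAdd
      simpa only [this] using ha)
  -- Columns off `S` use the slice formulas in `x`; columns in `S` use the original formulas with
  -- `x` moved among the parameters.
  refine ⟨#(Sᶜ : Set I), #S, ?_, ?_, ?_⟩
  · rw [add_comm, Cardinal.mk_sum_compl]
  · choose ψ hψ using exists_formula_meetsSlice (m := m) (n := n) φ b
    refine hasPattern_of_forall_finite M (fun i : (Sᶜ : Set I) => ψ (f i) i) fun J c => ?_
    obtain ⟨g, hg1, hg2⟩ := hf (J.map (Function.Embedding.subtype _)) (by
      intro i hi
      obtain ⟨j, -, rfl⟩ := Finset.mem_map.1 (Finset.mem_coe.1 hi)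
      exact j.2) c
    refine ⟨fun i t a => b (ofLex a.1.1).1 (g i t a.1.1) a.2, ?_, ?_⟩
    · intro i hi t ht a
      rw [hψ, hψ]
      exact hg1 i (Finset.mem_map_of_mem _ hi) t ht a
    · intro η hη
      obtain ⟨x, hx⟩ := hg2 (fun i => if hi : i ∈ Sᶜ then η ⟨i, hi⟩ else 0) (fun i => by
        split_ifs
        · exact hη _
        · exact Nat.zero_le _)
      refine ⟨x, fun i hi t ht => ?_⟩
      rw [hψ, hx i (Finset.mem_map_of_mem _ hi) t ht, dif_pos i.2]
  · refine hasPattern_of_forall_finite M (γ := fun i : S => Fin m ⊕ Fin (k i))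
      (fun i : S => (φ i).relabel (Sum.elim
        (Fin.append (fun w => Sum.inr (Sum.inl w)) Sum.inl) fun z => Sum.inr (Sum.inr z)))
      fun J c => ?_
    obtain ⟨x, q, hq, hx⟩ := hS (J.map (Function.Embedding.subtype _)) (by
      intro i hi
      obtain ⟨j, -, rfl⟩ := Finset.mem_map.1 (Finset.mem_coe.1 hi)
      exact j.2) c
    have key : ∀ (i : S) (t : ℕ) (y : Fin n → M),
        ((φ i).relabel (Sum.elim (Fin.append (fun w => Sum.inr (Sum.inl w)) Sum.inl)
          fun z => Sum.inr (Sum.inr z)) : L.Formula (Fin n ⊕ (Fin m ⊕ Fin (k i)))).Realize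
          (Sum.elim y (Sum.elim x (b i (q i t)))) ↔
        Fin.append x y ∈ definedSet (φ i) (b i (q i t)) := by
      intro i t y
      simp only [definedSet, Set.mem_ofPred_eq, FirstOrder.Language.Formula.realize_relabel]
      rw [iff_iff_eq]
      congr 1
      funext w
      rcases w with w | w
      · refine Fin.addCases (fun w => ?_) (fun w => ?_) w <;> simp
      · simp
    have hmono : ∀ i p p' (a : Fin (m + n) → M), p ≤ p' → a ∈ definedSet (φ i) (b i p) →
        a ∈ definedSet (φ i) (b i p') := fun i p p' a hp h =>
      (monotone_nat_of_le_succ (f := fun p => definedSet (φ i) (b i p)) fun p => (hss i p).1) hp h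
    refine ⟨fun i t => Sum.elim x (b i (q i t)), ?_, ?_⟩
    · intro i hi t ht y
      rw [key, key]
      exact hmono _ _ _ _ (hq i (Finset.mem_map_of_mem _ hi) t ht)
    · intro η hη
      obtain ⟨y, hy⟩ := hx (fun i => if hi : i ∈ S then η ⟨i, hi⟩ else 0) (fun i => by
        split_ifs
        · exact hη _
        · exact Nat.zero_le _)
      refine ⟨y, fun i hi t ht => ?_⟩
      rw [key, hy i (Finset.mem_map_of_mem _ hi) t ht, dif_pos i.2]

/-! ### Widths of patterns and cardinal arithmetic -/

theorem HasPattern.mono_width {m : ℕ} {κ κ' : Cardinal.{max u v}} (h : HasPattern T m κ)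
    (hκ : κ' ≤ κ) : HasPattern T m κ' := by
  classical
  obtain ⟨M, I, rfl, k, φ, b, hcon, hss⟩ := h
  obtain ⟨J, rfl⟩ := Cardinal.le_mk_iff_exists_set.1 hκ
  refine ⟨M, J, rfl, fun i => k i, fun i => φ i, fun i => b i, fun η s => ?_, fun i => hss i⟩
  obtain ⟨a, ha⟩ := hcon (fun i => if hi : i ∈ J then η ⟨i, hi⟩ else 0)
    (s.image fun p => (p.1.1, p.2))
  refine ⟨a, fun p hp => ?_⟩
  have := ha _ (Finset.mem_image_of_mem _ hp)
  simpa using this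

theorem HasPattern.mono_variables {m m' : ℕ} {κ : Cardinal.{max u v}} (h : HasPattern T m κ)
    (hm : m ≤ m') : HasPattern T m' κ := by
  obtain ⟨M, I, rfl, k, φ, b, hcon, hss⟩ := h
  obtain ⟨d, rfl⟩ := Nat.exists_eq_add_of_le hm
  have key : ∀ i t (a : Fin (m + d) → M),
      a ∈ definedSet ((φ i).relabel (Sum.map (Fin.castAdd d) id)) (b i t) ↔
        (fun w => a (Fin.castAdd d w)) ∈ definedSet (φ i) (b i t) := by
    intro i t a
    simp only [definedSet, Set.mem_ofPred_eq, FirstOrder.Language.Formula.realize_relabel,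
      Sum.elim_comp_map, Function.comp_id]
    rfl
  refine ⟨M, I, rfl, k, fun i => (φ i).relabel (Sum.map (Fin.castAdd d) id), b,
    IsPattern.of_subset (fun η s => ?_) fun i j a ha => ?_⟩
  · obtain ⟨a, ha⟩ := hcon η s
    have z : M := Classical.choice inferInstance
    refine ⟨Fin.append a fun _ => z, fun p hp => ?_⟩
    rw [key]
    simpa using ha p hp
  · rw [key] at ha ⊢
    exact (hss i j).1 ha

theorem hasPattern_zero_width (hT : T.IsSatisfiable) (m : ℕ) : HasPattern T m 0 := by
  obtain ⟨M⟩ := hT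
  have z : M := Classical.choice inferInstance
  exact ⟨M, PEmpty, by simp, PEmpty.elim, fun i => i.elim, fun i => i.elim,
    fun η s => ⟨fun _ => z, fun p => p.1.elim⟩, fun i => i.elim⟩

/-- A column needs two consecutive strict inclusions, but there is only one `0`-tuple. -/
theorem not_hasPattern_zero_variables : ¬ HasPattern T 0 1 := by
  rintro ⟨M, I, hI, k, φ, b, -, hss⟩
  obtain ⟨i⟩ : Nonempty I := Cardinal.mk_ne_zero_iff.1 (by rw [hI]; exact one_ne_zero)
  obtain ⟨x, hx, -⟩ := Set.exists_of_ssubset (hss i 0)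
  obtain ⟨y, -, hy⟩ := Set.exists_of_ssubset (hss i 1)
  exact hy (Subsingleton.elim x y ▸ hx)

/-- The cardinals below `κ_srd^m(T)` are exactly the widths of patterns. -/
theorem lt_kappaSrdAt_iff {m : ℕ} {κ : Cardinal.{max u v}} :
    (κ : WithTop Cardinal.{max u v}) < kappaSrdAt T m ↔ HasPattern T m κ := by
  constructor
  · intro h
    by_contra hcon
    exact absurd h (not_lt.2 (sInf_le ⟨κ, hcon, rfl⟩))
  · intro h
    -- Widths are closed downwards, so a cardinal that is not a width is at least the successor of
    -- `κ`.
    refine lt_of_lt_of_le (WithTop.coe_lt_coe.2 (Order.lt_succ κ)) (le_sInf ?_)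
    rintro _ ⟨μ, hμ, rfl⟩
    exact WithTop.coe_le_coe.2 (Order.succ_le_of_lt (not_le.1 fun hle => hμ (h.mono_width hle)))

theorem kappaSrdAt_le_iff {m : ℕ} {κ : Cardinal.{max u v}} :
    kappaSrdAt T m ≤ κ ↔ ¬ HasPattern T m κ := by
  rw [← lt_kappaSrdAt_iff, not_lt]

theorem kappaSrdAt_mono {m m' : ℕ} (h : m ≤ m') : kappaSrdAt T m ≤ kappaSrdAt T m' := by
  induction hκ : kappaSrdAt T m' with
  | top => exact le_top
  | coe κ =>
    rw [kappaSrdAt_le_iff]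
    intro hp
    exact kappaSrdAt_le_iff.1 hκ.le (hp.mono_variables h)

theorem kappaSrdAt_add_one_le (hT : T.IsSatisfiable) (m n : ℕ) :
    kappaSrdAt T (m + n) + 1 ≤ kappaSrdAt T m + kappaSrdAt T n := by
  induction hm : kappaSrdAt T m with
  | top => simp
  | coe α =>
  induction hn : kappaSrdAt T n with
  | top => simp
  | coe β =>
  have hα := kappaSrdAt_le_iff.1 hm.le
  have hβ := kappaSrdAt_le_iff.1 hn.le
  suffices ∃ γ : Cardinal.{max u v}, γ + 1 ≤ α + β ∧ ¬ HasPattern T (m + n) γ by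
    obtain ⟨γ, hγ, hp⟩ := this
    refine (add_le_add_left (kappaSrdAt_le_iff.2 hp) 1).trans ?_
    exact_mod_cast hγ
  have hlt : ∀ {l : ℕ} {κ κ' : Cardinal.{max u v}}, HasPattern T l κ → ¬ HasPattern T l κ' →
      κ < κ' := fun h h' => not_le.1 fun hle => h' (h.mono_width hle)
  have hα0 : 0 < α := hlt (hasPattern_zero_width hT m) hα
  have hβ0 : 0 < β := hlt (hasPattern_zero_width hT n) hβ
  rcases lt_or_ge (α + β) ℵ₀ with hfin | hinf
  · obtain ⟨hαf, hβf⟩ := Cardinal.add_lt_aleph0_iff.1 hfin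
    obtain ⟨a, rfl⟩ := Cardinal.lt_aleph0.1 hαf
    obtain ⟨c, rfl⟩ := Cardinal.lt_aleph0.1 hβf
    have ha : 0 < a := by exact_mod_cast hα0
    have hc : 0 < c := by exact_mod_cast hβ0
    -- The two parts of a split have widths at most `a - 1` and `c - 1`, hence total at most `a + c
    -- - 2`.
    refine ⟨((a + c - 1 : ℕ) : Cardinal), ?_, fun hp => ?_⟩
    · have : a + c - 1 + 1 ≤ a + c := by omega
      exact_mod_cast this
    · obtain ⟨κ₁, κ₂, hκ, h₁, h₂⟩ := hp.split
      have h₁ := hlt h₁ hα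
      have h₂ := hlt h₂ hβ
      obtain ⟨p, rfl⟩ := Cardinal.lt_aleph0.1 (h₁.trans hαf)
      obtain ⟨q, rfl⟩ := Cardinal.lt_aleph0.1 (h₂.trans hβf)
      norm_cast at h₁ h₂ hκ
      omega
  -- Two cardinals below the infinite `α + β` cannot add up to it, and the extra `1` is absorbed.
  · refine ⟨α + β, (Cardinal.add_one_eq hinf).le, fun hp => ?_⟩
    obtain ⟨κ₁, κ₂, hκ, h₁, h₂⟩ := hp.split
    have h₁ := (hlt h₁ hα).trans_le (le_self_add (a := α) (b := β))
    have h₂ := (hlt h₂ hβ).trans_le (le_add_self (a := β) (b := α))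
    exact (Cardinal.add_lt_of_lt hinf h₁ h₂).ne hκ

theorem kappaSrdAt_zero_lt_aleph0 :
    kappaSrdAt T 0 < ((ℵ₀ : Cardinal.{max u v}) : WithTop Cardinal.{max u v}) :=
  (kappaSrdAt_le_iff.2 not_hasPattern_zero_variables).trans_lt
    (WithTop.coe_lt_coe.2 Cardinal.one_lt_aleph0)

theorem kappaSrdAt_le_of_aleph0_le (hT : T.IsSatisfiable) {μ : Cardinal.{max u v}} (hμ : ℵ₀ ≤ μ)
    (h : kappaSrdAt T 1 ≤ μ) (m : ℕ) : kappaSrdAt T m ≤ μ := by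
  induction m with
  | zero => exact (kappaSrdAt_mono zero_le_one).trans h
  | succ m ih =>
    refine (le_self_add.trans (kappaSrdAt_add_one_le hT m 1)).trans ((add_le_add ih h).trans ?_)
    exact_mod_cast (Cardinal.add_eq_self hμ).le

/-- Subadditivity keeps finite values finite when one variable is added; contrapositively, an
infinite value at any `m` forces one at `1`. -/
theorem kappaSrdAt_one_lt_aleph0_imp (hT : T.IsSatisfiable)
    (h : kappaSrdAt T 1 < ((ℵ₀ : Cardinal.{max u v}) : WithTop Cardinal.{max u v})) (m : ℕ) :
    kappaSrdAt T m < ((ℵ₀ : Cardinal.{max u v}) : WithTop Cardinal.{max u v}) := by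
  induction m with
  | zero => exact kappaSrdAt_zero_lt_aleph0
  | succ m ih =>
    refine (le_self_add.trans (kappaSrdAt_add_one_le hT m 1)).trans_lt ?_
    obtain ⟨α, hα⟩ := WithTop.ne_top_iff_exists.1 ih.ne_top
    obtain ⟨β, hβ⟩ := WithTop.ne_top_iff_exists.1 h.ne_top
    rw [← hα] at ih ⊢
    rw [← hβ] at h ⊢
    exact_mod_cast Cardinal.add_lt_aleph0 (WithTop.coe_lt_coe.1 ih) (WithTop.coe_lt_coe.1 h)

end Split
end SRD

theorem corollary3p2 {L : FirstOrder.Language.{u, v}} (T : L.Theory) (hT : T.IsComplete) :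
    (∀ m n : ℕ, kappaSrdAt T (m + n) + 1 ≤ kappaSrdAt T m + kappaSrdAt T n) ∧
    (∀ m : ℕ, ((ℵ₀ : Cardinal.{max u v}) : WithTop Cardinal.{max u v}) ≤ kappaSrdAt T m →
      kappaSrdAt T m = kappaSrdAt T 1 ∧ kappaSrdAt T 1 = kappaSrd T) := by
  refine ⟨SRD.kappaSrdAt_add_one_le hT.1, fun m hm => ?_⟩
  have h1 : ((ℵ₀ : Cardinal.{max u v}) : WithTop Cardinal.{max u v}) ≤ kappaSrdAt T 1 :=
    not_lt.1 fun h => absurd hm (not_le.2 (SRD.kappaSrdAt_one_lt_aleph0_imp hT.1 h m))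
  have hle : ∀ l : ℕ, kappaSrdAt T l ≤ kappaSrdAt T 1 := by
    intro l
    induction hκ : kappaSrdAt T 1 with
    | top => exact le_top
    | coe μ =>
      exact SRD.kappaSrdAt_le_of_aleph0_le hT.1 (WithTop.coe_le_coe.1 (hκ ▸ h1)) hκ.le l
  -- The value at `m = 0` is finite, so `m ≥ 1` and monotonicity in the number of variables applies.
  have hm0 : 1 ≤ m := Nat.one_le_iff_ne_zero.2 fun h => by
    subst h
    exact absurd hm (not_le.2 SRD.kappaSrdAt_zero_lt_aleph0)
  exact ⟨(hle m).antisymm (SRD.kappaSrdAt_mono hm0),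
    (le_iSup (fun m : ℕ => kappaSrdAt T m) 1).antisymm (iSup_le hle)⟩
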